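/- Let $p$ be a prime, let $\mathbb F_q$ be a finite field of characteristic $p$ (with the discrete topology), let $\mathbf u=(u_n)_{n\ge 0}$ be a sequence in $\mathbb F_q$ and $F(t)=\sum_{n\ge 0}u_nt^n$. Suppose that $F(t)=R(t)+t^rG(t)$ with $r\ge 0$, $R\in\mathbb F_q[t]$, $G\in\mathbb F_q[[t]]$, $G(0)=0$, and that $P(t,G(t))=0$ for a polynomial $$P(t,x)=A_0(t)x+A_1(t)x^p+\cdots+A_m(t)x^{p^m}+B(t)=\sum_{i=0}^d C_i(x)t^i\in\mathbb F_q[t,x]$$ of degree $d$ in $t$ with $A_0(0)\ne 0$ and $B(0)=A_i(0)=0$ for $1\le i\le m$. (Then $F$ is algebraic over $\mathbb F_q(t)$, that is, $\mathbf u$ is $p$-automatic; conversely every $p$-automatic $\mathbf u$ admits such $R,r,G,P$.) Suppose moreover that $A_m(t)=\alpha t^d$ and $B(t)=\beta t^d$ with $\alpha,\beta\in\mathbb F_q\setminus\{0\}$, so that both are monomials of degree $d$. Let $s=\max(r,\deg R)$, where $\deg 0$ is read as $0$ (so $s=r$ when $R(t)=u_0+\cdots+u_rt^r$). Let $$\Phi:(\mathbb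 F_q^{\,d+s+1})^{\mathbb Z}\to(\mathbb F_q^{\,d+s+1})^{\mathbb Z}$$ be the map that sends $d+s+1$ consecutive rows $W_{n-d-s-1},\dots,W_{n-1}\in\mathbb F_q^{\mathbb Z}$ to $W_{n-d-s},\dots,W_{n}$, where, writing a row as $W(x)=\sum_{k\in\mathbb Z} W(k)x^k$, $$W_n(x)=-\sum_{i=1}^d\frac{C_i(x)}{C_0(x)}W_{n-i}(x).$$ Let $Z_0$ be the configuration consisting of the rows $W_0,\dots,W_{d+s}$, where $W_n(x)=u_nx^{-2}$ for $n\le s$, and for $n>s$ the row $W_n(x)$ is the coefficient of $t^{n-r}$ in the expansion of $\frac{\partial P}{\partial x}(t,x)/P(t,x)$ as a power series in $t$ with coefficients in $\mathbb F_q[x,x^{-1}]$. Then $\Phi$ is a linear cellular automaton (continuous, commuting with the shift, $\mathbb F_q$-linear), and the first entry of the cell in Column $-2$ of $\Phi^n(Z_0)$ is $u_n$ for all $n\ge 0$. Moreover there are integers $a\le -2\le b$ such that, for the sequence $\mathbf V=(V_n)_{n\ge 0}$ in which the letter $V_n$ is the block of columns $a,\dots,b$ of $\Phi^n(Z_0)$,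 the following hold. 1. The one-sided subshift $(X_{\mathbf V},\sigma)$, where $X_{\mathbf V}=\overline{\{\sigma^n(\mathbf V):n\ge 0\}}$, embeds in the linear cellular automaton $\Phi$: the set $Y=\overline{\{\Phi^n(Z_0):n\ge 0\}}$ is closed and $\Phi(Y)\subseteq Y$, and there is a homeomorphism $\Psi:Y\to X_{\mathbf V}$ with $\Psi\circ\Phi=\sigma\circ\Psi$ and $\Psi(Z_0)=\mathbf V$. 2. $X_{\mathbf u}=\overline{\{\sigma^n(\mathbf u):n\ge 0\}}$ is the image of $X_{\mathbf V}$ under the letter-to-letter projection that sends a block to the first entry of its cell in Column $-2$. In particular, $(X_{\mathbf u},\sigma)$ is the letter-to-letter projection of a subshift that can be embedded in a linear cellular automaton. -/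

import Mathlib

open Polynomial Set

noncomputable section

namespace LinearCA

/-! ### Symbolic dynamics -/

/-- The left shift map on sequences indexed by `ℕ` or `ℤ`. -/
def shift {M A : Type*} [Add M] [One M] (R : M → A) : M → A := fun m => R (m + 1)

/-- A cellular automaton on the alphabet `A`: a continuous shift-commuting self-map of `A^ℤ`.
(`A` is meant to carry the discrete topology, `A^ℤ` has the product topology.) -/
def IsCellularAutomaton {A : Type*} [TopologicalSpace A] (Φ : (ℤ → A) → (ℤ → A)) : Prop :=
  Continuous Φ ∧ ∀ R, Φ (shift R) = shift (Φ R)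

/-- A linear cellular automaton on the alphabet `𝔽^k`. -/
def IsLinearCellularAutomaton (𝔽 : Type*) [Field 𝔽] [TopologicalSpace 𝔽] {k : ℕ}
    (Φ : (ℤ → Fin k → 𝔽) → (ℤ → Fin k → 𝔽)) : Prop :=
  IsCellularAutomaton Φ ∧ IsLinearMap 𝔽 Φ

/-- `(X, T)` is a subsystem of the system given by `T` on the ambient space. -/
def IsSubsystem {Y : Type*} [TopologicalSpace Y] (T : Y → Y) (X : Set Y) : Prop :=
  IsClosed X ∧ MapsTo T X X

/-- `Ψ` is a topological conjugacy between the subsystems `(Y₀, T)` and `(X₀, S)`: a homeomorphism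
with `Ψ ∘ T = S ∘ Ψ` on `Y₀`. -/
def IsConjugacy {Y X : Type*} [TopologicalSpace Y] [TopologicalSpace X] (T : Y → Y) (S : X → X)
    {Y₀ : Set Y} {X₀ : Set X} (Ψ : Y₀ ≃ₜ X₀) : Prop :=
  ∀ Z Z' : Y₀, (Z' : Y) = T Z → (Ψ Z' : X) = S (Ψ Z)

/-- The closure of the forward orbit of `x` under `T`. -/
def orbitClosure {Y : Type*} [TopologicalSpace Y] (T : Y → Y) (x : Y) : Set Y :=
  closure (range fun n : ℕ => T^[n] x)

/-- The one-sided subshift `X_u` associated with the sequence `u`. -/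
def subshift {A : Type*} [TopologicalSpace A] (u : ℕ → A) : Set (ℕ → A) :=
  orbitClosure shift u

/-! ### The polynomial and its series -/

variable {F : Type*} [Field F]

/-- `P(t,x) = A₀(t) x + A₁(t) x^p + ⋯ + A_m(t) x^(p^m) + B(t)`, as a polynomial in `x` whose
coefficients are polynomials in `t`. -/
def bivP (p m : ℕ) (A : ℕ → F[X]) (B : F[X]) : F[X][X] :=
  ∑ i ∈ Finset.range (m + 1), C (A i) * X ^ (p ^ i) + C B

/-- The coefficient `C_i(x)` of `t^i` in `P(t,x)`, as a Laurent polynomial in `x`. -/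
def rowCoeff (P : F[X][X]) (i : ℕ) : LaurentPolynomial F :=
  toLaurent ((Bivariate.swap P).coeff i)

/-- A polynomial in `t` and `x` as a power series in `t` whose coefficients are Laurent
polynomials in `x`. -/
def toSeries (P : F[X][X]) : PowerSeries (LaurentPolynomial F) :=
  PowerSeries.mk (rowCoeff P)

/-- The expansion of `P_x(t,x) / P(t,x)` as a power series in `t` with coefficients in `F[x, x⁻¹]`.
It is used when the coefficient of `t^0` in `P` is a nonzero monomial in `x`, so that `P` is
invertible in that ring. -/
def logDerivSeries (P : F[X][X]) : PowerSeries (LaurentPolynomial F) :=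
  toSeries (derivative P) * Ring.inverse (toSeries P)

/-! ### The automaton -/

/-- Multiplication of a row `R = ∑ R(m) x^m` by a Laurent polynomial in `x`. -/
def laurentMul (L : LaurentPolynomial F) (R : ℤ → F) : ℤ → F :=
  fun m => ∑ j ∈ L.coeff.support, L.coeff j * R (m - j)

/-- The memory-`d` rule `(R_{n-d}, …, R_{n-1}) ↦ R_n = - ∑_{i=1}^d (C_i(x) / C_0(x)) R_{n-i}`,
with memory trivially increased to `d + s + 1`. A configuration `Z` lists `d + s + 1` consecutive
rows, the oldest one first, so `R_{n-(i+1)}` is the row with index `Fin.rev i`. -/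
def memoryRule (P : F[X][X]) (d s : ℕ) (Z : ℤ → Fin (d + s + 1) → F) : ℤ → F :=
  -∑ i : Fin d,
    laurentMul (rowCoeff P (i + 1) * Ring.inverse (rowCoeff P 0))
      (fun m => Z m (Fin.rev (Fin.castLE (by omega) i)))

/-- The memoryless automaton on the alphabet `F^(d+s+1)`: each cell discards its oldest entry,
moves the others up, and appends the value given by the rule with memory. -/
def automaton (P : F[X][X]) (d s : ℕ) (Z : ℤ → Fin (d + s + 1) → F) : ℤ → Fin (d + s + 1) → F :=
  fun m => Fin.snoc (α := fun _ => F) (Fin.tail (Z m)) (memoryRule P d s Z m)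

/-- Row `n` of the diagram of `u`. For `n ≤ s` it is `u_n x^(-2)`; for `n > s` it is the
coefficient of `t^(n-r)` in `P_x / P`. -/
def diagramRow (P : F[X][X]) (u : ℕ → F) (r s n : ℕ) : ℤ → F :=
  if n ≤ s then Pi.single (-2) (u n)
  else fun m => (PowerSeries.coeff (n - r) (logDerivSeries P)).coeff m

/-- The initial configuration of the automaton: rows `0, …, d + s` of the diagram. -/
def initialConfig (P : F[X][X]) (u : ℕ → F) (d r s : ℕ) : ℤ → Fin (d + s + 1) → F :=
  fun m j => diagramRow P u r s j m

/-- The block of columns `a, …, b` of the spacetime diagram of `Φ` started from `Z`, read as a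
one-sided sequence whose letters are blocks of width `b - a + 1`. -/
def columnBlock {A : Type*} (Φ : (ℤ → A) → (ℤ → A)) (Z : ℤ → A) (a b : ℤ) :
    ℕ → (Icc a b → A) :=
  fun n c => Φ^[n] Z c

end LinearCA

end

open LinearCA

noncomputable section

namespace LinearCA

variable {F : Type*} [Field F]

/-! ### Laurent polynomials and their action on rows -/

/-! In characteristic `p` the part of `P` containing `x` is additive, so `P(t,G) = 0` gives `P = ∑
A_i (x - G)^(p^i) = (x - G) D`, where `D` is a unit because `A_0(0) ≠ 0`. Moreover `P_x = A_0 = D -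
(x - G) Q`, hence `P_x / P = 1/(x - G) - Q/D`. The last quotient has no negative powers of `x`, so
columns `-1` and `-2` are those of `∑ G^k x^(-k-1)`, namely `1` and `G` (`coeff_logDerivSeries`).
Comparing powers of `t` in `P · (P_x / P) = A_0` shows that the rows obey the rule with memory
beyond degree `d` (`memoryRule_diagramRow`).

For the embedding, the rule is read as a relation between columns. Since `A_m = α t^d` and `B = β
t^d`, the relation in column `k` has one term at its right end, `β W_n(k)`, and one at its left end,
`α W_n(k - p^m)`. Either entry is thus determined by the columns in between, and `p^m` adjacent
columns determine the diagram (`eq_zero_of_rowRelation`).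

The artificial rows `0, …, s` break the relation. The tail of the orbit and its closure satisfy it,
while the point at time `s` violates it visibly in the chosen block; this separates the initial
points from the tail (`injOn_orbitClosure`). The reading map is then a continuous injection on a
compact orbit closure. -/

theorem laurent_coeff_mul (L M : LaurentPolynomial F) (k : ℤ) :
    (L * M).coeff k = ∑ j ∈ L.coeff.support, L.coeff j * M.coeff (k - j) := by
  classical
  have h := (L.coeff.sum_single).symm
  have hL : L = ∑ j ∈ L.coeff.support, AddMonoidAlgebra.single j (L.coeff j) := by
    apply AddMonoidAlgebra.coeff_injective
    simp only [AddMonoidAlgebra.coeff_sum, AddMonoidAlgebra.coeff_single]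
    exact h
  conv_lhs => rw [hL]
  rw [Finset.sum_mul, AddMonoidAlgebra.coeff_sum, Finsupp.finsetSum_apply]
  refine Finset.sum_congr rfl fun j _ => ?_
  rw [AddMonoidAlgebra.coeff_single_mul_apply]
  congr 2
  ring

theorem laurentMul_coeff (L M : LaurentPolynomial F) :
    laurentMul L (fun k => M.coeff k) = fun k => (L * M).coeff k := by
  funext k
  rw [laurent_coeff_mul]
  rfl

theorem coeff_C_mul_T_mul (a : F) (j : ℤ) (M : LaurentPolynomial F) (k : ℤ) :
    (LaurentPolynomial.C a * LaurentPolynomial.T j * M).coeff k = a * M.coeff (k - j) := by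
  rw [← LaurentPolynomial.single_eq_C_mul_T, AddMonoidAlgebra.coeff_single_mul_apply]
  congr 2
  ring

theorem coeff_T_mul (j : ℤ) (M : LaurentPolynomial F) (k : ℤ) :
    (LaurentPolynomial.T j * M).coeff k = M.coeff (k - j) := by
  simpa using coeff_C_mul_T_mul 1 j M k

theorem coeff_C_mul (a : F) (M : LaurentPolynomial F) (k : ℤ) :
    (LaurentPolynomial.C a * M).coeff k = a * M.coeff k := by
  simpa using coeff_C_mul_T_mul a 0 M k

theorem coeff_toLaurent_of_neg (f : F[X]) {k : ℤ} (hk : k < 0) : (toLaurent f).coeff k = 0 := by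
  rw [← Finsupp.notMem_support_iff, LaurentPolynomial.support_coeff_toLaurent]
  simp only [Finset.mem_map, not_exists, not_and]
  intro n _ h
  have : (n : ℤ) = k := h
  omega

/-! ### Bivariate polynomials as power series in `t` -/

/-- A polynomial in `t` and `x` as a power series in `t` with coefficients in `F[x]`. -/
def polySeries : F[X][X] →+* PowerSeries F[X] :=
  (Polynomial.coeToPowerSeries.ringHom).comp (Bivariate.swap (R := F)).toRingEquiv.toRingHom

theorem coeff_polySeries (P : F[X][X]) (n : ℕ) :
    PowerSeries.coeff n (polySeries P) = (Bivariate.swap P).coeff n := by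
  simp [polySeries]

theorem toSeries_eq_map (P : F[X][X]) :
    toSeries P = PowerSeries.map toLaurent (polySeries P) := by
  ext1 n
  simp [toSeries, rowCoeff, coeff_polySeries]

theorem polySeries_C (f : F[X]) :
    polySeries (C f) = PowerSeries.map (C : F →+* F[X]) (f : PowerSeries F) := by
  ext1 n
  rw [coeff_polySeries, Bivariate.swap_C]
  simp

theorem polySeries_X : polySeries (X : F[X][X]) = PowerSeries.C (X : F[X]) := by
  have h : Bivariate.swap (X : F[X][X]) = C X := Bivariate.swap_Y
  ext1 n
  rw [coeff_polySeries, h, PowerSeries.coeff_C, coeff_C]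

theorem coeff_swap_bivP (p m : ℕ) (A : ℕ → F[X]) (B : F[X]) (n : ℕ) :
    (Bivariate.swap (bivP p m A B)).coeff n =
      ∑ i ∈ Finset.range (m + 1), C ((A i).coeff n) * X ^ (p ^ i) + C (B.coeff n) := by
  rw [← coeff_polySeries, bivP, map_add, map_sum, map_add, map_sum]
  congr 1
  · refine Finset.sum_congr rfl fun i _ => ?_
    rw [map_mul, map_pow, polySeries_C, polySeries_X, ← map_pow, PowerSeries.coeff_mul_C]
    simp
  · simp [polySeries_C]

theorem rowCoeff_bivP (p m : ℕ) (A : ℕ → F[X]) (B : F[X]) (n : ℕ) :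
    rowCoeff (bivP p m A B) n =
      ∑ i ∈ Finset.range (m + 1), LaurentPolynomial.C ((A i).coeff n) *
        LaurentPolynomial.T ((p ^ i : ℕ) : ℤ) + LaurentPolynomial.C (B.coeff n) := by
  rw [rowCoeff, coeff_swap_bivP]
  simp only [map_add, map_sum, map_mul, toLaurent_C, toLaurent_X_pow]

theorem derivative_bivP (p m : ℕ) [CharP F p] (A : ℕ → F[X]) (B : F[X]) :
    derivative (bivP p m A B) = C (A 0) := by
  rw [bivP, derivative_add, derivative_C, add_zero, derivative_sum, Finset.sum_range_succ']
  have h : ∀ i ∈ Finset.range m, derivative (C (A (i + 1)) * X ^ (p ^ (i + 1)) : F[X][X]) = 0 := by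
    intro i _
    have : ((p ^ (i + 1) : ℕ) : F[X]) = 0 := by
      rw [Nat.cast_pow, CharP.cast_eq_zero, zero_pow (by omega)]
    rw [derivative_C_mul, derivative_X_pow, this]
    simp
  rw [Finset.sum_eq_zero h]
  simp

/-- If `P(t, G(t)) = 0` then `P = (x - G) D` and `A₀ = D - (x - G) Q` with `D`, `Q` power series
in `t` over `F[x]` and `D` invertible. -/
theorem exists_factorization (p : ℕ) [Fact p.Prime] [CharP F p] (m : ℕ) (A : ℕ → F[X]) (B : F[X])
    (G : PowerSeries F) (hA0 : (A 0).coeff 0 ≠ 0)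
    (hA : ∀ i, 1 ≤ i → i ≤ m → (A i).coeff 0 = 0)
    (hPG : aeval G (bivP p m A B) = 0) :
    ∃ D Q : PowerSeries F[X], IsUnit D ∧
      polySeries (bivP p m A B) = (PowerSeries.C X - PowerSeries.map C G) * D ∧
      polySeries (C (A 0)) = D - (PowerSeries.C X - PowerSeries.map C G) * Q := by
  have hp : 2 ≤ p := (Fact.out : p.Prime).two_le
  set y : PowerSeries F[X] := PowerSeries.C X - PowerSeries.map C G with hy
  have : CharP (PowerSeries F[X]) p :=
    charP_of_injective_ringHom (f := PowerSeries.C (R := F[X])) PowerSeries.C_injective p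
  let c : ℕ → PowerSeries F[X] := fun i => PowerSeries.map C (A i : PowerSeries F)
  have hB : PowerSeries.map (C : F →+* F[X]) (B : PowerSeries F) =
      -∑ i ∈ Finset.range (m + 1), c i * (PowerSeries.map C G) ^ (p ^ i) := by
    have h := congrArg (PowerSeries.map (C : F →+* F[X])) hPG
    simp only [bivP, map_add, map_sum, map_mul, map_pow, aeval_C, aeval_X, map_zero] at h
    rw [eq_neg_iff_add_eq_zero, add_comm]
    exact h
  have hpow : ∀ i, y ^ (p ^ i) = y * y ^ (p ^ i - 1) := fun i => by
    rw [← pow_succ', Nat.sub_add_cancel (Nat.one_le_pow _ _ (by omega))]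
  have hpow2 : ∀ i, y ^ (p ^ (i + 1) - 1) = y * y ^ (p ^ (i + 1) - 2) := fun i => by
    have : 2 ≤ p ^ (i + 1) := hp.trans (Nat.le_self_pow (by omega) p)
    rw [← pow_succ']
    congr 1
    omega
  refine ⟨∑ i ∈ Finset.range (m + 1), c i * y ^ (p ^ i - 1),
    ∑ i ∈ Finset.range m, c (i + 1) * y ^ (p ^ (i + 1) - 2), ?_, ?_, ?_⟩
  · have hc : ∀ i, PowerSeries.constantCoeff (c i) = C ((A i).coeff 0) := fun i => by
      rw [← PowerSeries.coeff_zero_eq_constantCoeff_apply, PowerSeries.coeff_map, coeff_coe]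
    -- At `t = 0` only the term `i = 0` survives, and its power of `y` is `p^0 - 1 = 0`, so `D` has
    -- constant term `A_0(0)`.
    rw [PowerSeries.isUnit_iff_constantCoeff, map_sum, Finset.sum_range_succ',
      Finset.sum_eq_zero]
    · simpa [hc] using hA0
    · intro i hi
      have := hA (i + 1) (by omega) (by simpa using hi)
      simp [hc, this]
  -- Frobenius turns `x^(p^i) - G^(p^i)` into `(x - G)^(p^i)`.
  · rw [bivP, map_add, map_sum, polySeries_C, hB, Finset.mul_sum, ← sub_eq_add_neg,
      ← Finset.sum_sub_distrib]
    refine Finset.sum_congr rfl fun i _ => ?_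
    rw [map_mul, map_pow, polySeries_C, polySeries_X, mul_left_comm, ← hpow, hy,
      sub_pow_char_pow, mul_sub]
  · rw [polySeries_C, Finset.sum_range_succ', Finset.mul_sum]
    have : ∀ i ∈ Finset.range m, c (i + 1) * y ^ (p ^ (i + 1) - 1) =
        y * (c (i + 1) * y ^ (p ^ (i + 1) - 2)) := fun i _ => by
      rw [hpow2]; ring
    rw [Finset.sum_congr rfl this]
    simp [c]

/-- The columns of index at least `-2` of the expansion of `1 / (x - G)`. -/
theorem coeff_of_sub_mul_eq_one (G : PowerSeries F) (hG : PowerSeries.constantCoeff G = 0)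
    (Y : PowerSeries (LaurentPolynomial F))
    (hY : (PowerSeries.C (LaurentPolynomial.T 1) -
      PowerSeries.map LaurentPolynomial.C G) * Y = 1) (n : ℕ) :
    (PowerSeries.coeff n Y).coeff (-1) = (if n = 0 then 1 else 0) ∧
      (PowerSeries.coeff n Y).coeff (-2) = PowerSeries.coeff n G := by
  -- Coefficient of `t^n x^(k+1)` in `x Y = G Y + 1`.
  have key : ∀ (n : ℕ) (k : ℤ), (PowerSeries.coeff n Y).coeff k =
      (∑ ij ∈ Finset.HasAntidiagonal.antidiagonal n,
        PowerSeries.coeff ij.1 G * (PowerSeries.coeff ij.2 Y).coeff (k + 1)) +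
        (if n = 0 ∧ k = -1 then 1 else 0) := by
    intro n k
    have h := congrArg (fun Z => (PowerSeries.coeff n Z).coeff (k + 1)) hY
    simp only [sub_mul, map_sub, PowerSeries.coeff_C_mul, AddMonoidAlgebra.coeff_sub,
      Finsupp.sub_apply, coeff_T_mul, add_sub_cancel_right, PowerSeries.coeff_one] at h
    rw [sub_eq_iff_eq_add] at h
    rw [h, PowerSeries.coeff_mul, AddMonoidAlgebra.coeff_sum, Finsupp.finsetSum_apply, add_comm]
    congr 1
    · refine Finset.sum_congr rfl fun ij _ => ?_
      rw [PowerSeries.coeff_map, coeff_C_mul]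
    · by_cases hn : n = 0
      · rw [if_pos hn, ← LaurentPolynomial.T_zero, LaurentPolynomial.T_apply]
        simp only [hn, true_and]
        congr 1
        apply propext
        omega
      · simp [hn]
  -- Because `G(0) = 0`, the recursion leads only to strictly earlier rows, whatever the column.
  have hpos : ∀ (n : ℕ) (k : ℤ), 0 ≤ k → (PowerSeries.coeff n Y).coeff k = 0 := by
    intro n
    induction n using Nat.strong_induction_on with
    | _ n ih =>
      intro k hk
      rw [key, if_neg (by omega), add_zero]
      refine Finset.sum_eq_zero fun ij hij => ?_
      rw [Finset.HasAntidiagonal.mem_antidiagonal] at hij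
      rcases Nat.eq_zero_or_pos ij.1 with h0 | h0
      · rw [h0, PowerSeries.coeff_zero_eq_constantCoeff_apply, hG, zero_mul]
      · rw [ih ij.2 (by omega) _ (by omega), mul_zero]
  have hneg : ∀ n : ℕ, (PowerSeries.coeff n Y).coeff (-1) = if n = 0 then 1 else 0 := by
    intro n
    rw [key, Finset.sum_eq_zero, zero_add]
    · simp
    · intro ij _
      rw [hpos _ _ (by norm_num), mul_zero]
  refine ⟨hneg n, ?_⟩
  rw [key, if_neg (by omega), add_zero, Finset.sum_eq_single (n, 0)]
  · simp only [show (-2 : ℤ) + 1 = -1 from rfl, hneg]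
    simp
  · rintro ⟨i, j⟩ hij hne
    rw [Finset.HasAntidiagonal.mem_antidiagonal] at hij
    have : j ≠ 0 := by
      rintro rfl
      exact hne (by simpa using hij)
    simp [hneg, show (-2 : ℤ) + 1 = -1 from rfl, this]
  · simp

section Expansion

variable (p m : ℕ) (A : ℕ → F[X]) (B : F[X])

/-- The vanishing conditions at `t = 0` leave `C_0(x) = A_0(0) x`, a unit Laurent monomial. Hence
the `Ring.inverse` in the definitions is a true inverse rather than its default value `0`. -/
theorem isUnit_rowCoeff_zero (hA0 : (A 0).coeff 0 ≠ 0)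
    (hA : ∀ i, 1 ≤ i → i ≤ m → (A i).coeff 0 = 0) (hB0 : B.coeff 0 = 0) :
    IsUnit (rowCoeff (bivP p m A B) 0) := by
  rw [rowCoeff_bivP, hB0, Finset.sum_range_succ', Finset.sum_eq_zero]
  · have h : IsUnit (LaurentPolynomial.C ((A 0).coeff 0)) :=
      (IsUnit.mk0 _ hA0).map (LaurentPolynomial.C (R := F))
    simpa using h.mul (LaurentPolynomial.isUnit_T (R := F) 1)
  · intro i hi
    rw [hA (i + 1) (by omega) (by simpa using hi)]
    simp

theorem toSeries_mul_logDerivSeries [CharP F p] (hA0 : (A 0).coeff 0 ≠ 0)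
    (hA : ∀ i, 1 ≤ i → i ≤ m → (A i).coeff 0 = 0) (hB0 : B.coeff 0 = 0) :
    toSeries (bivP p m A B) * logDerivSeries (bivP p m A B) = toSeries (C (A 0)) := by
  have hu : IsUnit (toSeries (bivP p m A B)) := by
    rw [PowerSeries.isUnit_iff_constantCoeff, ← PowerSeries.coeff_zero_eq_constantCoeff_apply,
      toSeries, PowerSeries.coeff_mk]
    exact isUnit_rowCoeff_zero p m A B hA0 hA hB0
  rw [logDerivSeries, derivative_bivP p, mul_left_comm, Ring.mul_inverse_cancel _ hu, mul_one]

/-- Columns `-1` and `-2` of the expansion of `P_x / P`. -/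
theorem coeff_logDerivSeries [Fact p.Prime] [CharP F p] (G : PowerSeries F) (hG : PowerSeries.constantCoeff G = 0)
    (hA0 : (A 0).coeff 0 ≠ 0)
    (hA : ∀ i, 1 ≤ i → i ≤ m → (A i).coeff 0 = 0) (hB0 : B.coeff 0 = 0)
    (hPG : aeval G (bivP p m A B) = 0) (n : ℕ) :
    (PowerSeries.coeff n (logDerivSeries (bivP p m A B))).coeff (-1) = (if n = 0 then 1 else 0) ∧
      (PowerSeries.coeff n (logDerivSeries (bivP p m A B))).coeff (-2) =
        PowerSeries.coeff n G := by
  obtain ⟨D, Q, hD, hP, hA'⟩ := exists_factorization p m A B G hA0 hA hPG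
  have hE := toSeries_mul_logDerivSeries p m A B hA0 hA hB0
  set E := logDerivSeries (bivP p m A B)
  obtain ⟨D, rfl⟩ := hD
  have hy : PowerSeries.map toLaurent (PowerSeries.C X - PowerSeries.map C G) =
      PowerSeries.C (LaurentPolynomial.T 1) - PowerSeries.map (LaurentPolynomial.C (R := F)) G := by
    ext1 n
    rw [map_sub, map_sub, PowerSeries.map_C, toLaurent_X]
    simp
  rw [toSeries_eq_map, toSeries_eq_map, hP, hA', map_mul, map_sub _ (D : PowerSeries F[X]), map_mul, hy] at hE
  set y := PowerSeries.C (LaurentPolynomial.T 1) - PowerSeries.map (LaurentPolynomial.C (R := F)) G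
  set τ := PowerSeries.map (toLaurent (R := F))
  have hinv : τ (D : PowerSeries F[X]) * τ ↑D⁻¹ = 1 := by
    rw [← map_mul, Units.mul_inv, map_one]
  -- Dividing `y D E = D - y Q` by `D` identifies `E + Q/D` with `1/(x - G)`.
  have h1 : y * (E + τ (Q * ↑D⁻¹)) = 1 := by
    rw [map_mul]
    linear_combination τ ↑D⁻¹ * hE + (1 - y * E) * hinv
  have h2 := coeff_of_sub_mul_eq_one G hG _ h1 n
  have h3 : ∀ k : ℤ, k < 0 → (PowerSeries.coeff n (E + τ (Q * ↑D⁻¹))).coeff k =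
      (PowerSeries.coeff n E).coeff k := by
    intro k hk
    rw [map_add, AddMonoidAlgebra.coeff_add, Finsupp.add_apply, PowerSeries.coeff_map,
      coeff_toLaurent_of_neg _ hk, add_zero]
  rwa [h3 _ (by norm_num), h3 _ (by norm_num)] at h2

/-- The rows of the expansion of `P_x / P` satisfy a recurrence of length `d`. -/
theorem sum_rowCoeff_mul_coeff [CharP F p] (d : ℕ) (hA0 : (A 0).coeff 0 ≠ 0)
    (hA : ∀ i, 1 ≤ i → i ≤ m → (A i).coeff 0 = 0) (hB0 : B.coeff 0 = 0)
    (hd : ∀ i ≤ m, (A i).natDegree ≤ d) (hBd : B.natDegree ≤ d) (n : ℕ) :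
    ∑ i ∈ Finset.range (d + 1), rowCoeff (bivP p m A B) i *
      PowerSeries.coeff (n + d - i) (logDerivSeries (bivP p m A B)) =
        LaurentPolynomial.C ((A 0).coeff (n + d)) := by
  have h := congrArg (PowerSeries.coeff (n + d)) (toSeries_mul_logDerivSeries p m A B hA0 hA hB0)
  rw [PowerSeries.coeff_mul, toSeries_eq_map (C (A 0)), PowerSeries.coeff_map, polySeries_C,
    PowerSeries.coeff_map, toLaurent_C, coeff_coe, Finset.Nat.sum_antidiagonal_eq_sum_range_succ_mk]
    at h
  rw [← h]
  simp only [toSeries, PowerSeries.coeff_mk]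
  -- The terms with `i > d` of the Cauchy product vanish, since `P` has degree at most `d` in `t`.
  refine Finset.sum_subset (fun i hi => ?_) fun i _ hi => ?_
  · simp only [Finset.mem_range] at hi ⊢
    omega
  · simp only [Finset.mem_range] at hi
    have : rowCoeff (bivP p m A B) i = 0 := by
      rw [rowCoeff_bivP, coeff_eq_zero_of_natDegree_lt (p := B) (by omega), Finset.sum_eq_zero]
      · simp
      · intro j hj
        rw [Finset.mem_range] at hj
        rw [coeff_eq_zero_of_natDegree_lt (lt_of_le_of_lt (hd j (by omega)) (by omega))]
        simp
    rw [this, zero_mul]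

end Expansion

/-! ### Orbit closures -/

section Dynamics

variable {Y X : Type*} [TopologicalSpace Y] [TopologicalSpace X]

theorem isSubsystem_orbitClosure {T : Y → Y} (hT : Continuous T) (x : Y) :
    IsSubsystem T (orbitClosure T x) := by
  refine ⟨isClosed_closure, MapsTo.closure ?_ hT⟩
  rintro _ ⟨n, rfl⟩
  exact ⟨n + 1, Function.iterate_succ_apply' T n x⟩

/-- A continuous map from a compact space to a Hausdorff space is closed, so taking images commutes
with closure. -/
theorem image_orbitClosure [CompactSpace Y] [T2Space X] {T : Y → Y} {S : X → X} {τ : Y → X}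
    (hτ : Continuous τ) (h : Function.Semiconj τ T S) (x : Y) :
    τ '' orbitClosure T x = orbitClosure S (τ x) := by
  rw [orbitClosure, ← hτ.isClosedMap.closure_image_eq_of_continuous hτ, ← range_comp, orbitClosure]
  congr 2
  funext n
  exact (h.iterate_right n).eq x

theorem exists_homeomorph_orbitClosure [CompactSpace Y] [T2Space X] {T : Y → Y} {S : X → X}
    {τ : Y → X} (hτ : Continuous τ) (h : Function.Semiconj τ T S) (x : Y)
    (hinj : InjOn τ (orbitClosure T x)) :
    ∃ Ψ : orbitClosure T x ≃ₜ orbitClosure S (τ x), ∀ Z, (Ψ Z : X) = τ Z := by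
  have himg := image_orbitClosure hτ h x
  have hbij : BijOn τ (orbitClosure T x) (orbitClosure S (τ x)) := by
    rw [← himg]
    exact hinj.bijOn_image
  have : CompactSpace (orbitClosure T x) :=
    isCompact_iff_compactSpace.mp isClosed_closure.isCompact
  have hc : Continuous (hbij.equiv τ) :=
    Continuous.subtype_mk (hτ.comp continuous_subtype_val) _
  exact ⟨hc.homeoOfEquivCompactToT2, fun _ => rfl⟩

/-- A factor map is injective on an orbit closure as soon as it is injective on the closure of the
tail of the orbit after time `s` and separates the point at time `s` from that closure. -/
theorem injOn_orbitClosure {X : Type*} [T1Space Y] {T : Y → Y} {S : X → X} {τ : Y → X} (hT : Continuous T)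
    (h : Function.Semiconj τ T S) (x : Y) (s : ℕ)
    (h1 : InjOn τ (closure ((fun n => T^[n] x) '' Ioi s)))
    (h2 : ∀ Z ∈ closure ((fun n => T^[n] x) '' Ioi s), τ Z ≠ τ (T^[s] x)) :
    InjOn τ (orbitClosure T x) := by
  set K := closure ((fun n => T^[n] x) '' Ioi s)
  -- The first `s + 1` orbit points form a finite, hence closed, set; they add nothing new to the
  -- closure.
  have hsplit : ∀ Z ∈ orbitClosure T x, (∃ n ≤ s, Z = T^[n] x) ∨ Z ∈ K := by
    intro Z hZ
    rw [orbitClosure, ← image_univ, ← Iic_union_Ioi (a := s), image_union, closure_union,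
      ((finite_Iic s).image _).isClosed.closure_eq] at hZ
    rcases hZ with ⟨n, hn, rfl⟩ | hZ
    · exact Or.inl ⟨n, hn, rfl⟩
    · exact Or.inr hZ
  have hK : MapsTo T K K := by
    refine MapsTo.closure ?_ hT
    rintro _ ⟨n, hn, rfl⟩
    exact ⟨n + 1, Nat.lt_succ_of_lt hn, Function.iterate_succ_apply' T n x⟩
  -- Applying `T^[s - n]` moves a coincidence with time `n` to one with time `s`, which `h2`
  -- excludes.
  have hne : ∀ n ≤ s, ∀ Z, T^[s - n] Z ∈ K → τ Z ≠ τ (T^[n] x) := by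
    intro n hn Z hZ heq
    refine h2 _ hZ ?_
    rw [(h.iterate_right (s - n)).eq, heq, ← (h.iterate_right (s - n)).eq,
      ← Function.iterate_add_apply, Nat.sub_add_cancel hn]
  have hlt : ∀ n k, n ≤ s → n < k → τ (T^[k] x) ≠ τ (T^[n] x) := by
    intro n k hn hk
    refine hne n hn _ (subset_closure ⟨s - n + k, ?_, Function.iterate_add_apply T _ _ x⟩)
    simp only [mem_Ioi]
    omega
  intro Z hZ Z' hZ' heq
  rcases hsplit Z hZ with ⟨n, hn, rfl⟩ | hZK <;> rcases hsplit Z' hZ' with ⟨k, hk, rfl⟩ | hZK'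
  · rcases lt_trichotomy n k with hlt' | rfl | hlt'
    · exact absurd heq.symm (hlt n k hn hlt')
    · rfl
    · exact absurd heq (hlt k n hk hlt')
  · exact absurd heq.symm (hne n hn _ (hK.iterate _ hZK'))
  · exact absurd heq (hne k hk _ (hK.iterate _ hZK))
  · exact h1 hZK hZK' heq

end Dynamics

/-! ### The automaton -/

theorem laurentMul_add (L : LaurentPolynomial F) (R R' : ℤ → F) :
    laurentMul L (R + R') = laurentMul L R + laurentMul L R' := by
  funext k
  simp [laurentMul, mul_add, Finset.sum_add_distrib]

theorem laurentMul_smul (L : LaurentPolynomial F) (c : F) (R : ℤ → F) :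
    laurentMul L (c • R) = c • laurentMul L R := by
  funext k
  simp [laurentMul, Finset.mul_sum, mul_left_comm]

theorem laurentMul_shift (L : LaurentPolynomial F) (R : ℤ → F) :
    laurentMul L (shift R) = shift (laurentMul L R) := by
  funext k
  simp only [laurentMul, shift]
  refine Finset.sum_congr rfl fun j _ => ?_
  congr 2
  ring

section Automaton

variable (P : F[X][X]) (d s : ℕ)

theorem automaton_castSucc (Z : ℤ → Fin (d + s + 1) → F) (k : ℤ) (j : Fin (d + s)) :
    automaton P d s Z k j.castSucc = Z k j.succ := by
  rw [automaton, Fin.snoc_castSucc, Fin.tail]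

theorem automaton_last (Z : ℤ → Fin (d + s + 1) → F) (k : ℤ) :
    automaton P d s Z k (Fin.last (d + s)) = memoryRule P d s Z k := by
  rw [automaton, Fin.snoc_last]

theorem isLinearCellularAutomaton_automaton [TopologicalSpace F] [DiscreteTopology F] :
    IsLinearCellularAutomaton F (automaton P d s) := by
  refine ⟨⟨?_, fun Z => ?_⟩, ⟨fun Z Z' => ?_, fun c Z => ?_⟩⟩
  · refine continuous_pi fun k => continuous_pi fun j => ?_
    refine Fin.lastCases ?_ (fun j => ?_) j
    · simp only [automaton_last, memoryRule, Pi.neg_apply, Finset.sum_apply, laurentMul]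
      fun_prop
    · simp only [automaton_castSucc]
      fun_prop
  · funext k j
    refine Fin.lastCases ?_ (fun j => ?_) j
    · rw [automaton_last, shift, automaton_last]
      simp only [memoryRule, Pi.neg_apply, Finset.sum_apply]
      congr 1
      refine Finset.sum_congr rfl fun i _ => ?_
      exact congrFun (laurentMul_shift _ fun m => Z m (Fin.rev (Fin.castLE _ i))) k
    · rw [automaton_castSucc, shift, shift, automaton_castSucc]
  · funext k j
    refine Fin.lastCases ?_ (fun j => ?_) j
    · simp only [Pi.add_apply, automaton_last, memoryRule, Pi.neg_apply, Finset.sum_apply]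
      rw [← neg_add, ← Finset.sum_add_distrib]
      congr 1
      refine Finset.sum_congr rfl fun i _ => ?_
      exact congrFun (laurentMul_add _ (fun m => Z m (Fin.rev (Fin.castLE _ i)))
        fun m => Z' m (Fin.rev (Fin.castLE _ i))) k
    · simp only [Pi.add_apply, automaton_castSucc]
  · funext k j
    refine Fin.lastCases ?_ (fun j => ?_) j
    · simp only [Pi.smul_apply, automaton_last, memoryRule, Pi.neg_apply, Finset.sum_apply]
      rw [smul_neg, Finset.smul_sum]
      congr 1
      refine Finset.sum_congr rfl fun i _ => ?_
      exact congrFun (laurentMul_smul _ c fun m => Z m (Fin.rev (Fin.castLE _ i))) k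
    · simp only [Pi.smul_apply, automaton_castSucc]

/-- The entry number `j` of a cell becomes the oldest one after `j` steps. -/
theorem iterate_automaton_apply (Z : ℤ → Fin (d + s + 1) → F) (n j : ℕ) (hj : j < d + s + 1)
    (k : ℤ) :
    (automaton P d s)^[n] Z k ⟨j, hj⟩ = (automaton P d s)^[n + j] Z k 0 := by
  induction j generalizing n with
  | zero => rfl
  | succ j ih =>
    have h := automaton_castSucc P d s ((automaton P d s)^[n] Z) k ⟨j, by omega⟩
    rw [← Function.iterate_succ_apply' (automaton P d s)] at h
    rw [show n + (j + 1) = n + 1 + j by ring, ← ih (n + 1) (by omega)]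
    exact h.symm

/-- If the rows `W` obey the rule with memory, then the automaton scrolls through them. -/
theorem iterate_automaton_eq (W : ℕ → ℤ → F)
    (hW : ∀ n, memoryRule P d s (fun k j => W (n + j) k) = W (n + (d + s + 1))) (n : ℕ) :
    (automaton P d s)^[n] (fun k (j : Fin (d + s + 1)) => W j k) =
      fun k (j : Fin (d + s + 1)) => W (n + j) k := by
  induction n with
  | zero => simp
  | succ n ih =>
    rw [Function.iterate_succ_apply', ih]
    funext k j
    refine Fin.lastCases ?_ (fun j => ?_) j
    · rw [automaton_last, hW, Fin.val_last]
      congr 1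
      ring
    · rw [automaton_castSucc, Fin.val_succ, Fin.val_castSucc]
      congr 1
      ring

end Automaton

/-! ### The linear relation between the rows of the spacetime diagram -/

section Relation

variable (p m d : ℕ) (A : ℕ → F[X]) (β : F)

/-- The entry in column `k` of `∑ i, C_i(x) W_{n+d-i}(x)`, when `B = β t^d`. -/
def rowRelation (W : ℕ → ℤ → F) (n : ℕ) (k : ℤ) : F :=
  ∑ i ∈ Finset.range (d + 1), ∑ l ∈ Finset.range (m + 1),
    (A l).coeff i * W (n + d - i) (k - (p ^ l : ℕ)) + β * W n k

theorem rowRelation_sub (W W' : ℕ → ℤ → F) (n : ℕ) (k : ℤ) :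
    rowRelation p m d A β (fun n k => W n k - W' n k) n k =
      rowRelation p m d A β W n k - rowRelation p m d A β W' n k := by
  simp only [rowRelation, mul_sub, Finset.sum_sub_distrib]
  ring

theorem rowRelation_congr {W W' : ℕ → ℤ → F} {n : ℕ} {k : ℤ} (hp : 0 < p)
    (h : ∀ n, ∀ c, k - (p ^ m : ℕ) ≤ c → c ≤ k → W n c = W' n c) :
    rowRelation p m d A β W n k = rowRelation p m d A β W' n k := by
  rw [rowRelation, rowRelation, h n k (by omega) le_rfl]
  congr 1
  refine Finset.sum_congr rfl fun i _ => Finset.sum_congr rfl fun l hl => ?_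
  have : p ^ l ≤ p ^ m := Nat.pow_le_pow_right hp (by simpa [Nat.lt_succ_iff] using hl)
  rw [h _ _ (by omega) (by omega)]

theorem coeff_sum_rowCoeff_mul (M : ℕ → LaurentPolynomial F) (n : ℕ) (k : ℤ) :
    (∑ i ∈ Finset.range (d + 1), rowCoeff (bivP p m A (monomial d β)) i *
      M (n + d - i)).coeff k = rowRelation p m d A β (fun n k => (M n).coeff k) n k := by
  have h : ∀ i, (rowCoeff (bivP p m A (monomial d β)) i * M (n + d - i)).coeff k =
      ∑ l ∈ Finset.range (m + 1), (A l).coeff i * (M (n + d - i)).coeff (k - (p ^ l : ℕ)) +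
        (if i = d then β * (M n).coeff k else 0) := by
    intro i
    rw [rowCoeff_bivP, add_mul, Finset.sum_mul, AddMonoidAlgebra.coeff_add, Finsupp.add_apply,
      AddMonoidAlgebra.coeff_sum, Finsupp.finsetSum_apply, coeff_C_mul, coeff_monomial]
    congr 1
    · exact Finset.sum_congr rfl fun l _ => coeff_C_mul_T_mul _ _ _ _
    · by_cases hi : i = d
      · simp [hi]
      · rw [if_neg (Ne.symm hi), if_neg hi, zero_mul]
  rw [AddMonoidAlgebra.coeff_sum, Finsupp.finsetSum_apply, Finset.sum_congr rfl fun i _ => h i,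
    Finset.sum_add_distrib, rowRelation]
  congr 1
  rw [Finset.sum_ite_eq' (Finset.range (d + 1)) d, if_pos (by simp)]

variable {p m d A β}

/-- Rows that satisfy the relation and vanish in `p^m` consecutive columns vanish. -/
theorem eq_zero_of_rowRelation (hp : 2 ≤ p) {α : F} (hα : α ≠ 0) (hβ : β ≠ 0)
    (hAm : A m = monomial d α) {W : ℕ → ℤ → F} (hW : ∀ n k, rowRelation p m d A β W n k = 0)
    {a b : ℤ} (hab : a + (p ^ m : ℕ) ≤ b + 1) (h0 : ∀ n k, a ≤ k → k ≤ b → W n k = 0)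
    (n : ℕ) (k : ℤ) : W n k = 0 := by
  have hpos : ∀ l, 0 < p ^ l := fun l => Nat.pow_pos (by omega)
  -- Rightwards: all other terms of the relation in column `k` lie in the `p^m` columns before it,
  -- leaving `β W_n(k) = 0`.
  have hright : ∀ (j : ℕ) (n : ℕ) (k : ℤ), a ≤ k → k ≤ b + j → W n k = 0 := by
    intro j
    induction j with
    | zero =>
      intro n k hk hkb
      exact h0 n k hk (by simpa using hkb)
    | succ j ih =>
      intro n k hk hkb
      by_cases hkj : k ≤ b + j
      · exact ih n k hk hkj
      have h := hW n k
      rw [rowRelation, Finset.sum_eq_zero, zero_add] at h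
      · exact (mul_eq_zero.mp h).resolve_left hβ
      · refine fun i _ => Finset.sum_eq_zero fun l hl => ?_
        have h1 : p ^ l ≤ p ^ m :=
          Nat.pow_le_pow_right (by omega) (by simpa [Nat.lt_succ_iff] using hl)
        have h2 := hpos l
        rw [ih _ _ (by omega) (by omega), mul_zero]
  -- Leftwards: in column `k + p^m` of the relation, column `k` is reached only through `A_m = α
  -- t^d`, that is, by the single term `α W_n(k)`.
  have hleft : ∀ (j : ℕ) (n : ℕ) (k : ℤ), a - j ≤ k → W n k = 0 := by
    intro j
    induction j with
    | zero =>
      intro n k hk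
      exact hright (k - b).toNat n k (by simpa using hk) (by omega)
    | succ j ih =>
      intro n k hk
      have h := hW n (k + (p ^ m : ℕ))
      have h2 := hpos m
      rw [rowRelation, ih _ (k + (p ^ m : ℕ)) (by omega), mul_zero, add_zero,
        Finset.sum_eq_single d, Finset.sum_range_succ, Finset.sum_eq_zero] at h
      · rw [hAm, coeff_monomial, if_pos rfl, zero_add, Nat.add_sub_cancel, add_sub_cancel_right]
          at h
        exact (mul_eq_zero.mp h).resolve_left hα
      · intro l hl
        have : p ^ l < p ^ m := Nat.pow_lt_pow_right (by omega) (by simpa using hl)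
        rw [ih _ _ (by omega), mul_zero]
      · intro i _ hi
        refine Finset.sum_eq_zero fun l hl => ?_
        rcases Nat.lt_succ_iff_lt_or_eq.mp (Finset.mem_range.mp hl) with hl | rfl
        · have : p ^ l < p ^ m := Nat.pow_lt_pow_right (by omega) hl
          rw [ih _ _ (by omega), mul_zero]
        · rw [hAm, coeff_monomial, if_neg (Ne.symm hi), zero_mul]
      · simp
  exact hleft (a - k).toNat n k (by omega)

/-- If only the row `0` of `W` is nonzero, that row vanishes far to the left, and the relation
holds in negative columns, then the negative columns of `W` are zero. -/
theorem eq_zero_of_rowRelation_of_neg (hp : 2 ≤ p) (hβ : β ≠ 0) {W : ℕ → ℤ → F}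
    (hW0 : ∀ n k, n ≠ 0 → W n k = 0) {c : ℤ} (hc : ∀ k < c, W 0 k = 0)
    (hW : ∀ k, c ≤ k → k < 0 → rowRelation p m d A β W 0 k = 0) (k : ℤ) (hk : k < 0) :
    W 0 k = 0 := by
  -- Sweeping from left to right, each new column of the relation reduces to `β W_0(k) = 0`.
  have hall : ∀ (j : ℕ) (n : ℕ) (k : ℤ), k < c + j → k < 0 → W n k = 0 := by
    intro j
    induction j with
    | zero =>
      intro n k hkc _
      rcases eq_or_ne n 0 with rfl | hn
      · exact hc k (by simpa using hkc)
      · exact hW0 n k hn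
    | succ j ih =>
      intro n k hkc hk
      rcases eq_or_ne n 0 with rfl | hn
      · by_cases hck : k < c
        · exact hc k hck
        have h := hW k (by omega) hk
        rw [rowRelation, Finset.sum_eq_zero, zero_add] at h
        · exact (mul_eq_zero.mp h).resolve_left hβ
        · refine fun i _ => Finset.sum_eq_zero fun l _ => ?_
          have : 0 < p ^ l := Nat.pow_pos (by omega)
          rw [ih _ _ (by omega) (by omega), mul_zero]
      · exact hW0 n k hn
  exact hall (k - c + 1).toNat 0 k (by omega) hk

end Relation

/-! ### The spacetime diagram -/

theorem diagramRow_of_lt (P : F[X][X]) (u : ℕ → F) (r : ℕ) {s n : ℕ} (hn : s < n) :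
    diagramRow P u r s n = fun k => (PowerSeries.coeff (n - r) (logDerivSeries P)).coeff k := by
  rw [diagramRow, if_neg (by omega)]

theorem exists_forall_lt_coeff_eq_zero (L : LaurentPolynomial F) :
    ∃ c : ℤ, ∀ k < c, L.coeff k = 0 := by
  obtain ⟨c, hc⟩ := L.coeff.support.bddBelow
  refine ⟨c, fun k hk => ?_⟩
  by_contra h
  exact absurd (hc (Finsupp.mem_support_iff.mpr h)) (by omega)

theorem apply_eq_coeff_add_coeff {u : ℕ → F} {R : F[X]} {r : ℕ} {G : PowerSeries F}
    (hF : PowerSeries.mk u = (R : PowerSeries F) + PowerSeries.X ^ r * G) {n : ℕ} (hn : r ≤ n) :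
    u n = R.coeff n + PowerSeries.coeff (n - r) G := by
  have h := congrArg (PowerSeries.coeff n) hF
  rwa [PowerSeries.coeff_mk, map_add, coeff_coe, PowerSeries.coeff_X_pow_mul', if_pos hn] at h

section Diagram

variable {p m r d s : ℕ} {u : ℕ → F} {A : ℕ → F[X]} {B R : F[X]} {G : PowerSeries F}

/-- The rule reads only the last `d` of the `d + s + 1` stored rows, namely `n + s + 1, …, n + s +
d`. All of them come after row `s`, so they are rows of `P_x / P`; the extra memory merely keeps the
artificial rows out of the rule. -/
theorem memoryRule_diagramRow [CharP F p] (hrs : r ≤ s) (hA0 : (A 0).coeff 0 ≠ 0)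
    (hA : ∀ i, 1 ≤ i → i ≤ m → (A i).coeff 0 = 0) (hB0 : B.coeff 0 = 0)
    (hd : ∀ i ≤ m, (A i).natDegree ≤ d) (hBd : B.natDegree ≤ d) (n : ℕ) :
    memoryRule (bivP p m A B) d s (fun k j => diagramRow (bivP p m A B) u r s (n + j) k) =
      diagramRow (bivP p m A B) u r s (n + (d + s + 1)) := by
  have hu := isUnit_rowCoeff_zero p m A B hA0 hA hB0
  have hrec := sum_rowCoeff_mul_coeff p m A B d hA0 hA hB0 hd hBd (n + s + 1 - r)
  set P := bivP p m A B
  set N := n + s + 1 - r with hN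
  have hdeg := hd 0 (by omega)
  -- Since `r ≤ s`, `N ≥ 1`, so `N + d` exceeds the degree of `A_0` and the right side is zero.
  rw [coeff_eq_zero_of_natDegree_lt (by omega), map_zero, Finset.sum_range_succ'] at hrec
  have hinv := Ring.inverse_mul_cancel _ hu
  set I := Ring.inverse (rowCoeff P 0)
  have hrow : ∀ i : Fin d, laurentMul (rowCoeff P (i + 1) * I)
      (fun k => diagramRow P u r s (n + (Fin.rev (Fin.castLE (by omega) i) : Fin (d + s + 1))) k) =
      fun k => (rowCoeff P (i + 1) * I *
        PowerSeries.coeff (N + d - (i + 1)) (logDerivSeries P)).coeff k := by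
    intro i
    have hi := i.isLt
    have hidx : ((Fin.rev (Fin.castLE (by omega) i) : Fin (d + s + 1)) : ℕ) = d + s - i := by
      rw [Fin.val_rev, Fin.val_castLE]
      omega
    rw [hidx, diagramRow_of_lt P u r (by omega), ← laurentMul_coeff,
      show n + (d + s - i) - r = N + d - (i + 1) by omega]
  have hE : PowerSeries.coeff (N + d) (logDerivSeries P) =
      -∑ i ∈ Finset.range d, rowCoeff P (i + 1) * I *
        PowerSeries.coeff (N + d - (i + 1)) (logDerivSeries P) := by
    have hsum : ∑ i ∈ Finset.range d, rowCoeff P (i + 1) * I *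
        PowerSeries.coeff (N + d - (i + 1)) (logDerivSeries P) =
        I * ∑ i ∈ Finset.range d, rowCoeff P (i + 1) *
          PowerSeries.coeff (N + d - (i + 1)) (logDerivSeries P) := by
      rw [Finset.mul_sum]
      exact Finset.sum_congr rfl fun i _ => by ring
    rw [Nat.sub_zero] at hrec
    rw [hsum]
    linear_combination I * hrec - PowerSeries.coeff (N + d) (logDerivSeries P) * hinv
  rw [memoryRule, Finset.sum_congr rfl fun i _ => hrow i, diagramRow_of_lt P u r (by omega),
    show n + (d + s + 1) - r = N + d by omega, hE]
  funext k
  rw [Pi.neg_apply, Finset.sum_apply, AddMonoidAlgebra.coeff_neg, Finsupp.neg_apply,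
    AddMonoidAlgebra.coeff_sum, Finsupp.finsetSum_apply,
    Fin.sum_univ_eq_sum_range (fun i => (rowCoeff P (i + 1) * I *
      PowerSeries.coeff (N + d - (i + 1)) (logDerivSeries P)).coeff k)]

/-- As `A_0` does not involve `x`, the inhomogeneous term sits in column `0` alone. Negative columns
therefore satisfy the relation even at the start `q = s - r`, where that term may be nonzero. -/
theorem rowRelation_logDerivSeries [CharP F p] {β : F} (hA0 : (A 0).coeff 0 ≠ 0)
    (hA : ∀ i, 1 ≤ i → i ≤ m → (A i).coeff 0 = 0) (hB0 : (monomial d β).coeff 0 = 0)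
    (hd : ∀ i ≤ m, (A i).natDegree ≤ d) (q n : ℕ) (k : ℤ) :
    rowRelation p m d A β (fun n k => (PowerSeries.coeff (q + n)
      (logDerivSeries (bivP p m A (monomial d β)))).coeff k) n k =
      if k = 0 then (A 0).coeff (q + n + d) else 0 := by
  have hrec := sum_rowCoeff_mul_coeff p m A (monomial d β) d hA0 hA hB0 hd
    (natDegree_monomial_le β) (q + n)
  have h := coeff_sum_rowCoeff_mul p m d A β (fun j =>
    PowerSeries.coeff (q + j) (logDerivSeries (bivP p m A (monomial d β)))) n k
  rw [← h, ← LaurentPolynomial.C_apply, ← hrec]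
  congr 2
  refine Finset.sum_congr rfl fun i hi => ?_
  rw [Finset.mem_range] at hi
  rw [show q + (n + d - i) = q + n + d - i by omega]

/-- From time `s + 1` on, the rows of the diagram satisfy the relation defined by `P`. -/
theorem rowRelation_diagramRow [CharP F p] {β : F} (hrs : r ≤ s) (hA0 : (A 0).coeff 0 ≠ 0)
    (hA : ∀ i, 1 ≤ i → i ≤ m → (A i).coeff 0 = 0) (hB0 : (monomial d β).coeff 0 = 0)
    (hd : ∀ i ≤ m, (A i).natDegree ≤ d) {q : ℕ} (hq : s < q) (n : ℕ) (k : ℤ) :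
    rowRelation p m d A β
      (fun n => diagramRow (bivP p m A (monomial d β)) u r s (q + n)) n k = 0 := by
  have h := rowRelation_logDerivSeries (p := p) hA0 hA hB0 hd (q - r) n k
  have hdeg := hd 0 (by omega)
  rw [coeff_eq_zero_of_natDegree_lt (by omega), ite_self] at h
  rw [← h]
  congr 1
  funext j
  rw [diagramRow_of_lt _ u r (by omega), show q + j - r = q - r + j by omega]

/-- Column `-2` of the diagram is the sequence `u`. -/
theorem diagramRow_neg_two [Fact p.Prime] [CharP F p]
    (hF : PowerSeries.mk u = (R : PowerSeries F) + PowerSeries.X ^ r * G)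
    (hG : PowerSeries.constantCoeff G = 0) (hA0 : (A 0).coeff 0 ≠ 0)
    (hA : ∀ i, 1 ≤ i → i ≤ m → (A i).coeff 0 = 0) (hB0 : B.coeff 0 = 0)
    (hPG : aeval G (bivP p m A B) = 0) (n : ℕ) :
    diagramRow (bivP p m A B) u r (max r R.natDegree) n (-2) = u n := by
  by_cases hn : n ≤ max r R.natDegree
  · rw [diagramRow, if_pos hn, Pi.single_eq_same]
  · rw [not_le] at hn
    rw [diagramRow_of_lt _ u r hn]
    refine (coeff_logDerivSeries p m A B G hG hA0 hA hB0 hPG _).2.trans ?_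
    rw [apply_eq_coeff_add_coeff hF (by omega), coeff_eq_zero_of_natDegree_lt (by omega), zero_add]

/-- Row `s` of the diagram differs in a negative column from the row of `P_x / P` that the
relation would put there. -/
theorem exists_neg_diagramRow_sub_ne_zero [Fact p.Prime] [CharP F p]
    (hF : PowerSeries.mk u = (R : PowerSeries F) + PowerSeries.X ^ r * G)
    (hG : PowerSeries.constantCoeff G = 0) (hA0 : (A 0).coeff 0 ≠ 0)
    (hA : ∀ i, 1 ≤ i → i ≤ m → (A i).coeff 0 = 0) (hB0 : B.coeff 0 = 0)
    (hPG : aeval G (bivP p m A B) = 0) (hs : s = max r R.natDegree) :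
    ∃ k < 0, diagramRow (bivP p m A B) u r s s k -
      (PowerSeries.coeff (s - r) (logDerivSeries (bivP p m A B))).coeff k ≠ 0 := by
  have hcol := coeff_logDerivSeries p m A B G hG hA0 hA hB0 hPG (s - r)
  -- If `s = r`, the series has `1` in column `-1` and row `s` has `0` there. Otherwise `s = deg R`,
  -- and in column `-2` the difference `u_s - G_(s-r)` is the leading coefficient of `R`.
  by_cases hsr : s = r
  · refine ⟨-1, by norm_num, ?_⟩
    rw [hcol.1, diagramRow, if_pos le_rfl, Pi.single_eq_of_ne (by norm_num), if_pos (by omega)]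
    simp
  · refine ⟨-2, by norm_num, ?_⟩
    have hR : s = R.natDegree := by omega
    have hR0 : R ≠ 0 := by
      rintro rfl
      rw [natDegree_zero] at hs hR
      omega
    rw [hcol.2, diagramRow, if_pos le_rfl, Pi.single_eq_same,
      apply_eq_coeff_add_coeff hF (by omega), add_sub_cancel_right, hR]
    exact leadingCoeff_ne_zero.mpr hR0

end Diagram

/-! ### Reading a block of columns -/

section ColumnBlock

variable {K : Type*} (Φ : (ℤ → K) → (ℤ → K)) (a b : ℤ)

theorem semiconj_columnBlock :
    Function.Semiconj (fun Z => columnBlock Φ Z a b) Φ (shift (M := ℕ)) := fun _ => rfl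

theorem continuous_columnBlock [TopologicalSpace K] (hΦ : Continuous Φ) :
    Continuous fun Z => columnBlock Φ Z a b := by
  refine continuous_pi fun n => continuous_pi fun c => ?_
  exact (continuous_apply (c : ℤ)).comp (hΦ.iterate n)

theorem continuous_shift_nat {K : Type*} [TopologicalSpace K] :
    Continuous (shift (M := ℕ) (A := K)) :=
  continuous_pi fun n => continuous_apply (n + 1)

end ColumnBlock

/-- The relation between rows passes from the tail of an orbit to its closure. -/
theorem rowRelation_eq_zero_of_mem_closure [TopologicalSpace F] [DiscreteTopology F]
    {p m d N : ℕ} {A : ℕ → F[X]} {β : F} {Φ : (ℤ → Fin (N + 1) → F) → (ℤ → Fin (N + 1) → F)}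
    (hΦ : Continuous Φ) {S : Set (ℤ → Fin (N + 1) → F)}
    (hS : ∀ Z ∈ S, ∀ n k, rowRelation p m d A β (fun n k => Φ^[n] Z k 0) n k = 0)
    {Z : ℤ → Fin (N + 1) → F} (hZ : Z ∈ closure S) (n : ℕ) (k : ℤ) :
    rowRelation p m d A β (fun n k => Φ^[n] Z k 0) n k = 0 := by
  have hc : ∀ n k, Continuous fun Z => Φ^[n] Z k 0 := fun n k =>
    (continuous_apply (0 : Fin (N + 1))).comp ((continuous_apply k).comp (hΦ.iterate n))
  have hclosed : IsClosed {Z | rowRelation p m d A β (fun n k => Φ^[n] Z k 0) n k = 0} := by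
    refine isClosed_eq ?_ continuous_const
    simp only [rowRelation]
    exact (continuous_finsetSum _ fun i _ => continuous_finsetSum _ fun l _ =>
      continuous_const.mul (hc _ _)).add (continuous_const.mul (hc _ _))
  exact closure_minimal (fun Z hZ => hS Z hZ n k) hclosed hZ

end LinearCA

end

open LinearCA

theorem corollary5p1
    (p : ℕ) [Fact p.Prime] {F : Type*} [Field F] [Finite F] [CharP F p]
    [TopologicalSpace F] [DiscreteTopology F]
    (u : ℕ → F)
    (m r d : ℕ) (A : ℕ → F[X]) (B R : F[X]) (G : PowerSeries F)
    -- the polynomial `P(t,x)` and the conditions that it satisfies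
    (hF : PowerSeries.mk u = (R : PowerSeries F) + PowerSeries.X ^ r * G)
    (hG : PowerSeries.constantCoeff G = 0)
    (hA0 : (A 0).coeff 0 ≠ 0)
    (hA : ∀ i, 1 ≤ i → i ≤ m → (A i).coeff 0 = 0)
    (hB0 : B.coeff 0 = 0)
    (hPG : aeval G (bivP p m A B) = 0)
    -- `d` is the degree of `P(t,x)` in `t`, and `A_m` and `B` are monomials of degree `d`
    (hd : ∀ i ≤ m, (A i).natDegree ≤ d)
    (α β : F) (hα : α ≠ 0) (hβ : β ≠ 0)
    (hAm : A m = monomial d α) (hB : B = monomial d β) :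
    let s := max r R.natDegree
    let Φ := automaton (bivP p m A B) d s
    let Z₀ := initialConfig (bivP p m A B) u d r s
    -- `Φ` is a linear cellular automaton, and its spacetime diagram started from `Z₀` has a column
    -- whose projection to first entries is `u`
    IsLinearCellularAutomaton F Φ ∧
    (∀ n, Φ^[n] Z₀ (-2) 0 = u n) ∧
    -- for some block of columns containing Column `-2`, with `V` the sequence read there, the
    -- subshift of `V` is conjugate to the subsystem of `Φ` generated by `Z₀`
    ∃ (a b : ℤ) (h : -2 ∈ Icc a b),
      let V := columnBlock Φ Z₀ a b
      IsSubsystem Φ (orbitClosure Φ Z₀) ∧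
      IsSubsystem shift (subshift V) ∧
      (∃ Ψ : orbitClosure Φ Z₀ ≃ₜ subshift V,
        IsConjugacy Φ (shift (M := ℕ)) Ψ ∧
        ∀ Z : orbitClosure Φ Z₀, (Z : ℤ → Fin (d + s + 1) → F) = Z₀ →
          (Ψ Z : ℕ → Icc a b → Fin (d + s + 1) → F) = V) ∧
      -- and `X_u` is its image under the letter-to-letter projection to the first entry of the
      -- letter in Column `-2`
      (fun (x : ℕ → Icc a b → Fin (d + s + 1) → F) (n : ℕ) => x n ⟨-2, h⟩ 0) '' subshift V =
        subshift u := by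
  intro s Φ Z₀
  have hp : 2 ≤ p := (Fact.out : p.Prime).two_le
  have hrs : r ≤ s := le_max_left _ _
  have hlin : IsLinearCellularAutomaton F Φ := isLinearCellularAutomaton_automaton _ d s
  have hΦ : Continuous Φ := hlin.1.1
  have hiter : ∀ n, Φ^[n] Z₀ =
      fun k (j : Fin (d + s + 1)) => diagramRow (bivP p m A B) u r s (n + j) k :=
    iterate_automaton_eq _ d s _ (memoryRule_diagramRow hrs hA0 hA hB0 hd
      (hB ▸ natDegree_monomial_le β))
  have hiter0 : ∀ n k, Φ^[n] Z₀ k 0 = diagramRow (bivP p m A B) u r s n k := fun n k => by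
    rw [hiter]
    rfl
  have hu : ∀ n, Φ^[n] Z₀ (-2) 0 = u n := fun n => by
    rw [hiter0]
    exact diagramRow_neg_two hF hG hA0 hA hB0 hPG n
  refine ⟨hlin, hu, ?_⟩
  obtain ⟨c, hc⟩ := exists_forall_lt_coeff_eq_zero
    (PowerSeries.coeff (s - r) (logDerivSeries (bivP p m A B)))
  have hpm : 0 < p ^ m := Nat.pow_pos (by omega)
  -- Left of `min c (-2)`, both row `s` and the corresponding row of the series vanish. The further
  -- `p^m` columns let the relation in each negative column from there on be read inside the block,
  -- which also has at least `p^m` columns.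
  let a : ℤ := min c (-2) - (p ^ m : ℕ)
  have h2 : (-2 : ℤ) ∈ Icc a (-1) := ⟨by omega, by norm_num⟩
  refine ⟨a, -1, h2, ?_⟩
  intro V
  have hsemi := semiconj_columnBlock Φ a (-1)
  have hcont := continuous_columnBlock Φ a (-1) hΦ
  -- all points in the closure of the tail of the orbit satisfy the relation
  have hrel : ∀ Z ∈ closure ((fun n => Φ^[n] Z₀) '' Ioi s), ∀ n k,
      rowRelation p m d A β (fun n k => Φ^[n] Z k 0) n k = 0 := by
    intro Z hZ
    refine rowRelation_eq_zero_of_mem_closure hΦ ?_ hZ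
    rintro _ ⟨q, hq, rfl⟩ n k
    subst hB
    rw [← rowRelation_diagramRow (p := p) (u := u) hrs hA0 hA hB0 hd hq n k]
    congr 1
    funext n k
    rw [← hiter0, Nat.add_comm q n, Function.iterate_add_apply]
  have happ : ∀ {Z Z' : ℤ → Fin (d + s + 1) → F},
      columnBlock Φ Z a (-1) = columnBlock Φ Z' a (-1) →
      ∀ n k, a ≤ k → k ≤ -1 → Φ^[n] Z k 0 = Φ^[n] Z' k 0 := fun h n k hk hk' =>
    congrFun (congrFun (congrFun h n) ⟨k, hk, hk'⟩) 0
  have hinj : InjOn (fun Z => columnBlock Φ Z a (-1)) (orbitClosure Φ Z₀) := by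
    refine injOn_orbitClosure hΦ hsemi Z₀ s (fun Z hZ Z' hZ' h => ?_) fun Z hZ h => ?_
    · have hzero := eq_zero_of_rowRelation (W := fun n k => Φ^[n] Z k 0 - Φ^[n] Z' k 0)
        hp hα hβ hAm (fun n k => by rw [rowRelation_sub, hrel Z hZ, hrel Z' hZ', sub_zero])
        (a := a) (b := -1) (by omega)
        fun n k hk hk' => sub_eq_zero.mpr (happ h n k hk hk')
      -- The relation controls first entries only; entry `j` of a cell is the first entry after `j`
      -- steps.
      funext k j
      have hj := sub_eq_zero.mp (hzero (0 + j) k)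
      rw [← iterate_automaton_apply, ← iterate_automaton_apply] at hj
      exact hj
    -- `W` is the diagram from row `s` on and `E` the unmodified series; they differ only in their
    -- row `0`. If `Z` had the same block as the point at time `s`, `W` would inherit the relation
    -- in negative columns, so `W` and `E` would agree there.
    · let E : ℕ → ℤ → F := fun n k =>
        (PowerSeries.coeff (s - r + n) (logDerivSeries (bivP p m A B))).coeff k
      let W : ℕ → ℤ → F := fun n k => diagramRow (bivP p m A B) u r s (s + n) k
      obtain ⟨k, hk, hne⟩ := exists_neg_diagramRow_sub_ne_zero hF hG hA0 hA hB0 hPG rfl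
      refine hne (eq_zero_of_rowRelation_of_neg (m := m) (d := d) (A := A)
        (W := fun n k => W n k - E n k) hp hβ (fun n k hn => ?_) (c := min c (-2))
        (fun k hk => ?_) (fun k hck hk => ?_) k hk)
      · simp only [W, E]
        rw [diagramRow_of_lt _ u r (by omega), show s + n - r = s - r + n by omega, sub_self]
      · simp only [W, E, Nat.add_zero]
        rw [hc k (by omega), diagramRow, if_pos le_rfl, Pi.single_eq_of_ne (by omega), sub_zero]
      · have hE : rowRelation p m d A β E 0 k = 0 := by
          subst hB
          exact (rowRelation_logDerivSeries (p := p) hA0 hA hB0 hd (s - r) 0 k).trans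
            (if_neg (by omega))
        rw [rowRelation_sub, hE, sub_zero, ← hrel Z hZ 0 k]
        refine rowRelation_congr p m d A β (by omega) fun n c hc hc' => ?_
        rw [happ h n c (by omega) (by omega), ← Function.iterate_add_apply, hiter0, Nat.add_comm n]
  refine ⟨isSubsystem_orbitClosure hΦ Z₀, isSubsystem_orbitClosure continuous_shift_nat V, ?_, ?_⟩
  · obtain ⟨Ψ, hΨ⟩ := exists_homeomorph_orbitClosure hcont hsemi Z₀ hinj
    refine ⟨Ψ, fun Z Z' h => ?_, fun Z hZ => ?_⟩
    · exact (hΨ Z').trans ((congrArg (fun Z => columnBlock Φ Z a (-1)) h).trans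
        (congrArg (shift (M := ℕ)) (hΨ Z).symm))
    · exact (hΨ Z).trans (congrArg (fun Z => columnBlock Φ Z a (-1)) hZ)
  · have hproj : Continuous fun (x : ℕ → Icc a (-1) → Fin (d + s + 1) → F) (n : ℕ) =>
        x n ⟨-2, h2⟩ 0 := by fun_prop
    have himg := image_orbitClosure (T := shift (M := ℕ)) (S := shift (M := ℕ)) hproj
      (fun _ => rfl) V
    rw [subshift, himg, subshift]
    congr 1
    funext n
    exact hu n
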